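/- Let $n\ge 2$, let $L$ be a lattice of rank $n$ in a real vector space $V$ of dimension $n$, and let $P\subset V$ be an $n$-dimensional convex polytope whose vertices lie in $L$. For a lattice $M\supseteq L$ in $V$, write $P_M$ for $P$ regarded as a lattice polytope with respect to $M$; let $E(P_M)\in\mathbb{Q}[t]$ be its Ehrhart polynomial, the polynomial with $E(P_M)(t)=\#(tP\cap M)$ for all integers $t\ge 0$; let $\operatorname{Vol}(P_M)$ be the volume of $P$ for the Haar measure on $V$ that gives a fundamental domain of $M$ volume $1$; and put $\tilde E(P_M)(t)=E(P_M)(t)-\operatorname{Vol}(P_M)\,t^n$. Write $E(P_L)=\sum_{l=0}^n c_l t^l$. For a prime $p$ let $\mathscr{L}_1(p)$ be the set of all superlattices of $L$ of coindex $p$, that is, of all lattices $M\supseteq L$ in $V$ with $[M:L]=p$. These Ehrhart polynomials exist, each $\mathscr{L}_1(p)$ is finite and non-empty, and the average $$A_p(t)=\frac{1}{\#\mathscr{L}_1(p)}\sum_{M\in\mathscr{L}_1(p)}\tilde E(P_M)(t)$$ is a polynomial of degree less than $n$. As $p\to\infty$ through the primes, $A_p$ converges coefficientwise: $$\lim_{\substack{p\to\infty\\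 p\text{ prime}}}A_p(t)=2c_{n-1}t^{n-1}+c_{n-2}t^{n-2}+\dots+c_1t+1 .$$ -/

import Mathlib

open Filter Topology MeasureTheory Polynomial
open scoped Pointwise

namespace EhrhartAverage

section Defs

variable {V : Type*} [NormedAddCommGroup V] [NormedSpace ℝ V]

/-- `M` is a (full-rank) lattice in `V`: a discrete subgroup spanning `V` over `ℝ`. -/
def IsLattice (M : Submodule ℤ V) : Prop :=
  ∃ _ : DiscreteTopology M, IsZLattice ℝ M

/-- `P` is a full-dimensional convex polytope in `V` (the convex hull of a finite set, with
affine hull `V`) all of whose vertices (extreme points) lie in `L`. -/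
structure IsLatticePolytope (L : Submodule ℤ V) (P : Set V) : Prop where
  polytope : ∃ s : Finset V, P = convexHull ℝ (s : Set V)
  vertices : P.extremePoints ℝ ⊆ (L : Set V)
  full_dim : affineSpan ℝ P = ⊤

/-- The number of points of `L` in the dilate `tP`. -/
noncomputable def latticePointCount (L : Submodule ℤ V) (P : Set V) (t : ℕ) : ℕ :=
  ((t : ℝ) • P ∩ (L : Set V)).ncard

/-- `q` is the Ehrhart polynomial of `P` with respect to `L`: `q(t) = #(tP ∩ L)` for every
nonnegative integer `t`, where each `tP ∩ L` is a finite set. -/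
def IsEhrhartPolynomial (L : Submodule ℤ V) (P : Set V) (q : ℚ[X]) : Prop :=
  ∀ t : ℕ, ((t : ℝ) • P ∩ (L : Set V)).Finite ∧
    q.eval (t : ℚ) = (latticePointCount L P t : ℚ)

theorem IsEhrhartPolynomial.unique {L : Submodule ℤ V} {P : Set V} {q r : ℚ[X]}
    (hq : IsEhrhartPolynomial L P q) (hr : IsEhrhartPolynomial L P r) : q = r := by
  refine Polynomial.eq_of_infinite_eval_eq q r
    ((Set.infinite_range_of_injective (Nat.cast_injective (R := ℚ))).mono ?_)
  rintro _ ⟨t, rfl⟩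
  exact (hq t).2.trans (hr t).2.symm

open Classical in
/-- The Ehrhart polynomial `E(P)` of `P` with respect to `L` (and `0` if there is none). -/
noncomputable def ehrhartPolynomial (L : Submodule ℤ V) (P : Set V) : ℚ[X] :=
  if h : ∃ q : ℚ[X], IsEhrhartPolynomial L P q then h.choose else 0

theorem IsEhrhartPolynomial.eq_ehrhartPolynomial {L : Submodule ℤ V} {P : Set V} {q : ℚ[X]}
    (hq : IsEhrhartPolynomial L P q) : ehrhartPolynomial L P = q := by
  have h : ∃ q : ℚ[X], IsEhrhartPolynomial L P q := ⟨q, hq⟩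
  rw [ehrhartPolynomial, dif_pos h]
  exact h.choose_spec.unique hq

/-- The superlattices of `L` of coindex `N`: the lattices `M ⊇ L` with `[M : L] = N`. -/
def superlattices (L : Submodule ℤ V) (N : ℕ) : Set (Submodule ℤ V) :=
  {M | IsLattice M ∧ L ≤ M ∧ L.toAddSubgroup.relIndex M.toAddSubgroup = N}

variable [FiniteDimensional ℝ V] [MeasurableSpace V] [BorelSpace V]

/-- The volume of `P` for the Haar measure on `V` that gives a fundamental domain of `L`
volume `1`. -/
noncomputable def latticeVolume (L : Submodule ℤ V) (P : Set V) : ℝ :=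
  (Measure.addHaar : Measure V).real P / ZLattice.covolume L (Measure.addHaar : Measure V)

/-- The regularized Ehrhart polynomial `E(P)(t) - Vol(P) t ^ n`, where `n = dim V`. -/
noncomputable def regularizedEhrhart (L : Submodule ℤ V) (P : Set V) : ℝ[X] :=
  (ehrhartPolynomial L P).map (algebraMap ℚ ℝ) -
    C (latticeVolume L P) * X ^ Module.finrank ℝ V

/-- The average of the regularized Ehrhart polynomials of `P` with respect to the lattices in
a finite family `S`. As a subset of `V` the polytope `P_M` is just `P`; only the lattice
changes. -/
noncomputable def averageRegularizedEhrhart (S : Set (Submodule ℤ V)) (P : Set V) : ℝ[X] :=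
  (S.ncard : ℝ)⁻¹ • ∑ᶠ M ∈ S, regularizedEhrhart M P

end Defs

end EhrhartAverage

/-!
# Averages of Ehrhart polynomials over superlattices of prime coindex

Write `E(P_L) = ∑ c_l t ^ l` and let `N` be the number of superlattices `M` of `L` of coindex `p`.

Every such `M` lies in `p⁻¹ L`, and as `p` is prime a point of `p⁻¹ L` outside `L` lies in exactly
one of them (`eq_sup_span_singleton_of_mem_superlattices`). Counting the points of `tP ∩ p⁻¹ L`
therefore gives `∑_M #(tP ∩ M) + #(tP ∩ L) = N #(tP ∩ L) + #(ptP ∩ L)`, so the coefficient of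
`t ^ l` in `∑_M E(P_M)` is `(N + p ^ l - 1) c_l` (`sum_coeff_realEhrhart_superlattices`). The
leading coefficient of `E(P_M)` is the volume of `P_M`, which is `p c_n`; for `l = n` the identity
thus reads `N p c_n = (N + p ^ n - 1) c_n`, which determines `N = (p ^ n - 1) / (p - 1)`.
Subtracting the volume term, the average has coefficients
`c_l (1 + (p ^ l - 1) (p - 1) / (p ^ n - 1))` for `l < n`, and `0` for `l ≥ n`. The fraction tends
to `1` for `l = n - 1` and to `0` for smaller `l`, and `c_0 = 1`.

The main ingredient is Ehrhart's theorem (`exists_isEhrhartPolynomial_convexHull`). Let `P` be the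
convex hull of lattice points `v_0, …, v_m`. Among the nonnegative coordinates `λ` with
`∑ λ_i = t` and `∑ λ_i v_i = x` there is a lexicographically largest one. Whether `λ` is
lexicographically largest depends only on its support, and the supports which occur form a
simplicial complex, the pulling triangulation, which is a cone with apex `v_0`. Split `λ = ρ + ν`,
where `ν` has natural entries, `ρ_0 ∈ [0, 1)`, and `ρ_i ∈ (0, 1]` for the other `i` with
`λ_i ≠ 0`. If `x` is a lattice point, `ρ` belongs to a finite set that does not depend on `t`, and
the `ν` that go with `ρ` are all the natural vectors supported on `v_0` and the support of `ρ`
whose sum is `t - ∑ ρ_i`. If `ρ` has `s` nonzero entries apart from `ρ_0`, the number of such `ν`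
is the binomial coefficient of `t + s - ∑ ρ_i` over `s`. Since `ρ_0 < 1` forces `∑ ρ_i ≤ s`, this
is a polynomial in `t` for all `t ≥ 0`, including `t = 0`.
-/

namespace EhrhartAverage

/-! ### The pulling triangulation -/

section Pulling

/-- A vector is lexicographically positive if its first nonzero entry is positive. -/
def LexPos {k : ℕ} (κ : Fin k → ℝ) : Prop :=
  ∃ i, 0 < κ i ∧ ∀ j < i, κ j = 0

theorem lexPos_or_lexPos_neg {k : ℕ} {κ : Fin k → ℝ} (h : κ ≠ 0) : LexPos κ ∨ LexPos (-κ) := by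
  obtain ⟨i, hi, hmin⟩ := (wellFounded_lt (α := Fin k)).has_min {i | κ i ≠ 0}
    (Function.ne_iff.mp h)
  have hz : ∀ j < i, κ j = 0 := fun j hj => by
    by_contra hne
    exact hmin j hne hj
  rcases lt_or_gt_of_ne hi with h0 | h0
  · exact .inr ⟨i, by simpa using h0, fun j hj => by simp [hz j hj]⟩
  · exact .inl ⟨i, h0, hz⟩

/-- A nonempty compact set has a lexicographically largest element: maximize the coordinates
one after the other. -/
theorem exists_lex_max {k : ℕ} {K : Set (Fin k → ℝ)} (hK : IsCompact K) (hne : K.Nonempty) :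
    ∃ l ∈ K, ∀ μ ∈ K, ¬ LexPos (μ - l) := by
  -- `K'` consists of the elements of `K` that are largest in the first `j` coordinates.
  have key : ∀ j ≤ k, ∃ K' ⊆ K, IsCompact K' ∧ K'.Nonempty ∧
      ∀ l ∈ K', ∀ μ ∈ K, (∀ i : Fin k, i.1 < j → (∀ i' < i, μ i' = l i') → μ i ≤ l i) ∧
        ((∀ i : Fin k, i.1 < j → μ i = l i) → μ ∈ K') := by
    intro j
    induction j with
    | zero => exact fun _ => ⟨K, subset_rfl, hK, hne, fun l _ μ hμ => ⟨by simp, fun _ => hμ⟩⟩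
    | succ j ih =>
      intro hj
      obtain ⟨K', hsub, hcomp, hne', h⟩ := ih (by omega)
      let J : Fin k := ⟨j, hj⟩
      obtain ⟨z, hz, hzmax⟩ := hcomp.exists_isMaxOn hne'
        (f := fun x : Fin k → ℝ => x J) (by fun_prop)
      refine ⟨K' ∩ {x | x J = z J}, fun x hx => hsub hx.1,
        hcomp.inter_right (isClosed_eq (by fun_prop) (by fun_prop)), ⟨z, hz, rfl⟩, ?_⟩
      rintro l ⟨hl, hlJ⟩ μ hμ
      have hlJ : l J = z J := hlJ
      refine ⟨fun i hi heq => ?_, fun heq => ⟨(h l hl μ hμ).2 fun i hi => heq i (by omega), ?_⟩⟩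
      · rcases Nat.lt_succ_iff_lt_or_eq.mp hi with hi | hi
        · exact (h l hl μ hμ).1 i hi heq
        · have hiJ : i = J := Fin.ext hi
          subst hiJ
          have : μ ∈ K' := (h l hl μ hμ).2 fun i' hi' => heq i' (by simpa [Fin.lt_def, J] using hi')
          rw [hlJ]
          exact hzmax this
      · change μ J = z J
        rw [← hlJ]
        exact heq J (Nat.lt_succ_self j)
  obtain ⟨K', hsub, -, ⟨l, hl⟩, h⟩ := key k le_rfl
  refine ⟨l, hsub hl, fun μ hμ ⟨i, hi, hz⟩ => ?_⟩
  have := (h l hl μ hμ).1 i i.2 fun i' hi' => sub_eq_zero.mp (hz i' hi')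
  simp only [Pi.sub_apply] at hi
  linarith

variable {V : Type*} [AddCommGroup V] [Module ℝ V] {m : ℕ}

/-- `S` is a face of the pulling triangulation of the points `v`: it is impossible to move
barycentric coordinates supported on `S` along an affine relation of `v` in a lexicographically
positive direction while keeping them nonnegative. The faces are the supports of the
lexicographically largest barycentric coordinates of the points of the convex hull of `v`. -/
def IsPullingFace (v : Fin (m + 1) → V) (S : Set (Fin (m + 1))) : Prop :=
  ∀ κ : Fin (m + 1) → ℝ, ∑ i, κ i = 0 → ∑ i, κ i • v i = 0 → LexPos κ → ∃ i ∉ S, κ i < 0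

variable {v : Fin (m + 1) → V}

theorem IsPullingFace.mono {S T : Set (Fin (m + 1))} (hT : IsPullingFace v T) (h : S ⊆ T) :
    IsPullingFace v S := fun κ h0 hv hp =>
  let ⟨i, hi, hneg⟩ := hT κ h0 hv hp
  ⟨i, fun hS => hi (h hS), hneg⟩

/-- The pulling triangulation is a cone with apex the first point, because the first entry of a
lexicographically positive vector is never negative. -/
theorem IsPullingFace.insert_zero {S : Set (Fin (m + 1))} (hS : IsPullingFace v S) :
    IsPullingFace v (insert 0 S) := by
  intro κ h0 hv hp
  obtain ⟨i, hi, hneg⟩ := hS κ h0 hv hp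
  refine ⟨i, ?_, hneg⟩
  rintro (rfl | h)
  · obtain ⟨j, hj, hz⟩ := hp
    rcases (Fin.zero_le j).eq_or_lt with h | h
    · rw [← h] at hj
      exact lt_asymm hj hneg
    · rw [hz 0 h] at hneg
      exact lt_irrefl _ hneg
  · exact hi h

/-- Barycentric coordinates supported on faces are determined by the point. -/
theorem IsPullingFace.coord_unique {l μ : Fin (m + 1) → ℝ} (hl0 : 0 ≤ l) (hμ0 : 0 ≤ μ)
    (hl : IsPullingFace v (Function.support l)) (hμ : IsPullingFace v (Function.support μ))
    (hs : ∑ i, l i = ∑ i, μ i) (hv : ∑ i, l i • v i = ∑ i, μ i • v i) : l = μ := by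
  by_contra hne
  rcases lexPos_or_lexPos_neg (sub_ne_zero.mpr hne) with hp | hp
  · obtain ⟨i, hi, hneg⟩ := hμ (l - μ) (by simp [hs]) (by simp [sub_smul, hv]) hp
    have : μ i = 0 := by simpa using hi
    have := hl0 i
    simp_all
    linarith
  · rw [neg_sub] at hp
    obtain ⟨i, hi, hneg⟩ := hl (μ - l) (by simp [hs]) (by simp [sub_smul, hv]) hp
    have : l i = 0 := by simpa using hi
    have := hμ0 i
    simp_all
    linarith

/-- Moving a little in a direction that is nonnegative wherever `l` vanishes keeps `l`
nonnegative. -/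
theorem exists_pos_nonneg_add_mul {ι : Type*} [Finite ι] {l κ : ι → ℝ} (hl : 0 ≤ l)
    (h : ∀ i, l i = 0 → 0 ≤ κ i) : ∃ ε : ℝ, 0 < ε ∧ 0 ≤ l + ε • κ := by
  have : ∀ᶠ ε : ℝ in 𝓝[>] 0, ∀ i, 0 ≤ l i + ε * κ i := by
    rw [eventually_all]
    intro i
    rcases (hl i).eq_or_lt with h0 | h0
    · filter_upwards [self_mem_nhdsWithin] with ε hε
      have := mul_nonneg (le_of_lt hε) (h i h0.symm)
      simp only [Pi.zero_apply] at h0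
      linarith
    · have hc : Tendsto (fun ε : ℝ => l i + ε * κ i) (𝓝[>] 0) (𝓝 (l i + 0 * κ i)) :=
        Tendsto.mono_left (Continuous.tendsto (by fun_prop) 0) nhdsWithin_le_nhds
      have h0 : (0 : ℝ) < l i + 0 * κ i := by simpa using h0
      filter_upwards [hc.eventually (lt_mem_nhds h0)] with ε hε using hε.le
  obtain ⟨ε, hpos, hε⟩ := (this.and self_mem_nhdsWithin).exists
  exact ⟨ε, hε, hpos⟩

end Pulling

section PullingNormed

variable {V : Type*} [NormedAddCommGroup V] [NormedSpace ℝ V] {m : ℕ} {v : Fin (m + 1) → V}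

/-- Lexicographically largest coordinates are supported on a face. -/
theorem exists_isPullingFace_support {μ : Fin (m + 1) → ℝ} (hμ : 0 ≤ μ) :
    ∃ l : Fin (m + 1) → ℝ, 0 ≤ l ∧ ∑ i, l i = ∑ i, μ i ∧ ∑ i, l i • v i = ∑ i, μ i • v i ∧
      IsPullingFace v (Function.support l) := by
  let K : Set (Fin (m + 1) → ℝ) :=
    {l | 0 ≤ l ∧ ∑ i, l i = ∑ i, μ i ∧ ∑ i, l i • v i = ∑ i, μ i • v i}
  have hK : IsCompact K := by
    refine (isCompact_univ_pi fun _ : Fin (m + 1) =>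
      isCompact_Icc (a := (0 : ℝ)) (b := ∑ i, μ i)).of_isClosed_subset ?_ ?_
    · have h1 : IsClosed {l : Fin (m + 1) → ℝ | ∑ i, l i = ∑ i, μ i} :=
        isClosed_eq (by fun_prop) (by fun_prop)
      have h2 : IsClosed {l : Fin (m + 1) → ℝ | ∑ i, l i • v i = ∑ i, μ i • v i} :=
        isClosed_eq (by fun_prop) (by fun_prop)
      exact isClosed_Ici.inter (h1.inter h2)
    · rintro l ⟨h0, hs, -⟩ i -
      exact ⟨h0 i, hs ▸ Finset.single_le_sum (fun j _ => h0 j) (Finset.mem_univ i)⟩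
  obtain ⟨l, ⟨h0, hs, hv⟩, hmax⟩ := exists_lex_max hK ⟨μ, hμ, rfl, rfl⟩
  refine ⟨l, h0, hs, hv, fun κ hκs hκv hκ => ?_⟩
  by_contra! hcon
  obtain ⟨ε, hε, hnn⟩ := exists_pos_nonneg_add_mul h0 fun i hi => hcon i (by simpa using hi)
  refine hmax (l + ε • κ) ⟨hnn, ?_, ?_⟩ ?_
  · simp [Finset.sum_add_distrib, ← Finset.mul_sum, hκs, hs]
  · simp [add_smul, mul_smul, Finset.sum_add_distrib, ← Finset.smul_sum, hκv, hv]
  · obtain ⟨i, hi, hz⟩ := hκ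
    exact ⟨i, by simpa using mul_pos hε hi, fun j hj => by simp [hz j hj]⟩

theorem mem_smul_convexHull_range {t : ℕ} {x : V} :
    x ∈ (t : ℝ) • convexHull ℝ (Set.range v) ↔
      ∃ μ : Fin (m + 1) → ℝ, 0 ≤ μ ∧ ∑ i, μ i = t ∧ ∑ i, μ i • v i = x := by
  have hull : convexHull ℝ (Set.range v) =
      (fun w : Fin (m + 1) → ℝ => ∑ i, w i • v i) '' stdSimplex ℝ (Fin (m + 1)) := by
    have := (Fintype.linearCombination ℝ v).image_convexHull
      (Set.range fun i j : Fin (m + 1) => if i = j then (1 : ℝ) else 0)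
    rw [convexHull_basis_eq_stdSimplex, ← Set.range_comp] at this
    convert! this.symm using 2
    ext i
    simp [Fintype.linearCombination_apply]
  rw [hull, Set.mem_smul_set]
  constructor
  · rintro ⟨_, ⟨w, ⟨hw0, hw1⟩, rfl⟩, rfl⟩
    refine ⟨(t : ℝ) • w, fun i => mul_nonneg t.cast_nonneg (hw0 i), ?_, ?_⟩
    · simp [← Finset.mul_sum, hw1]
    · simp [Finset.smul_sum, mul_smul]
  · rintro ⟨μ, h0, hs, rfl⟩
    rcases Nat.eq_zero_or_pos t with rfl | ht
    · -- The dilate by `0` is `{0}` because the convex hull is nonempty.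
      have hμ : ∀ i, μ i = 0 := fun i =>
        (Finset.sum_eq_zero_iff_of_nonneg fun i _ => h0 i).mp (by simpa using hs) i
          (Finset.mem_univ i)
      exact ⟨_, ⟨_, single_mem_stdSimplex ℝ 0, rfl⟩, by simp [hμ]⟩
    · have ht' : (t : ℝ) ≠ 0 := by positivity
      refine ⟨_, ⟨(t : ℝ)⁻¹ • μ, ⟨fun i => mul_nonneg (by positivity) (h0 i), ?_⟩, rfl⟩, ?_⟩
      · simp [← Finset.mul_sum, hs, ht']
      · simp [Finset.smul_sum, smul_smul, ht']

end PullingNormed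

/-! ### Ehrhart's theorem -/

section Counting

/-- Decompositions into a number in `[0, 1]` and a natural number are unique once `0 + n` is
excluded for `n ≠ 0`. -/
theorem eq_and_eq_of_add_natCast_eq {a b : ℝ} {k n : ℕ} (ha : 0 ≤ a) (ha1 : a ≤ 1) (hb : 0 ≤ b)
    (hb1 : b ≤ 1) (hk : a = 0 → k = 0) (hn : b = 0 → n = 0) (h : a + k = b + n) :
    a = b ∧ k = n := by
  rcases lt_trichotomy k n with hlt | rfl | hlt
  · have h1 : (k : ℝ) + 1 ≤ n := by exact_mod_cast hlt
    have := hn (by linarith)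
    omega
  · exact ⟨by linarith, rfl⟩
  · have h1 : (n : ℝ) + 1 ≤ k := by exact_mod_cast hlt
    have := hk (by linarith)
    omega

theorem exists_eval_eq_choose (d s : ℕ) :
    ∃ q : ℚ[X], ∀ t : ℕ, q.eval (t : ℚ) = ((t + d).choose s : ℕ) := by
  refine ⟨C (s.factorial : ℚ)⁻¹ * (descPochhammer ℚ s).comp (X + C (d : ℚ)), fun t => ?_⟩
  rw [Nat.cast_choose_eq_descPochhammer_div]
  simp [div_eq_inv_mul]

variable {V : Type*} [NormedAddCommGroup V] [NormedSpace ℝ V] {m : ℕ}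

/-- The barycentric coordinates of the lattice points in the half-open fundamental
parallelepipeds of the cones over the faces of the pulling triangulation that contain the apex:
the coordinate of the apex `v 0` lies in `[0, 1)`, the other nonzero ones in `(0, 1]`.
Their sum is a natural number, the degree of the point. -/
structure IsBoxCoord (v : Fin (m + 1) → V) (L : Submodule ℤ V) (ρ : Fin (m + 1) → ℝ) : Prop where
  nonneg : 0 ≤ ρ
  isFace : IsPullingFace v (Function.support ρ)
  mem : ∑ i, ρ i • v i ∈ L
  zero_lt_one : ρ 0 < 1
  le_one : ρ ≤ 1
  sum_eq : ∑ i, ρ i = (⌊∑ i, ρ i⌋₊ : ℝ)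

/-- The vertices other than the apex at which the coordinates `ρ` do not vanish. -/
noncomputable def tailSupport (ρ : Fin (m + 1) → ℝ) : Finset (Fin (m + 1)) :=
  {i | i ≠ 0 ∧ ρ i ≠ 0}

variable {v : Fin (m + 1) → V} {L : Submodule ℤ V} {ρ : Fin (m + 1) → ℝ}

/-- The degree of a box point is at most the dimension of its face. This is where the half-open
choice at the apex matters. -/
theorem IsBoxCoord.degree_le (h : IsBoxCoord v L ρ) :
    ⌊∑ i, ρ i⌋₊ ≤ (tailSupport ρ).card := by
  have h1 : ∑ i, ρ i = ρ 0 + ∑ i ∈ tailSupport ρ, ρ i := by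
    rw [← Finset.add_sum_erase _ _ (Finset.mem_univ 0)]
    congr 1
    symm
    apply Finset.sum_subset
    · intro i hi
      simp_all [tailSupport]
    · intro i hi hi'
      simp_all [tailSupport]
  have h2 : ∑ i ∈ tailSupport ρ, ρ i ≤ (tailSupport ρ).card := by
    simpa using Finset.sum_le_card_nsmul (tailSupport ρ) ρ 1 fun i _ => h.le_one i
  have h3 := h.zero_lt_one
  have h4 := h.sum_eq
  have : (⌊∑ i, ρ i⌋₊ : ℝ) < ((tailSupport ρ).card + 1 : ℕ) := by
    push_cast
    linarith
  exact Nat.lt_succ_iff.mp (by exact_mod_cast this)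

/-- Box coordinates are determined by the lattice point they represent and by its degree, which is
bounded. -/
theorem finite_setOf_isBoxCoord
    (hfin : ∀ t : ℕ, ((t : ℝ) • convexHull ℝ (Set.range v) ∩ (L : Set V)).Finite) :
    {ρ | IsBoxCoord v L ρ}.Finite := by
  let D : Set ℕ := Set.Iic (m + 1)
  refine Set.Finite.of_injOn (f := fun ρ : Fin (m + 1) → ℝ => (∑ i, ρ i, ∑ i, ρ i • v i))
    (t := ((fun d : ℕ => (d : ℝ)) '' D) ×ˢ
      ⋃ d ∈ D, ((d : ℝ) • convexHull ℝ (Set.range v) ∩ (L : Set V))) ?_ ?_ ?_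
  · intro ρ (h : IsBoxCoord v L ρ)
    have hd : ⌊∑ i, ρ i⌋₊ ∈ D :=
      h.degree_le.trans ((Finset.card_le_univ _).trans (by simp))
    refine ⟨⟨_, hd, h.sum_eq.symm⟩, Set.mem_biUnion hd ⟨?_, h.mem⟩⟩
    exact mem_smul_convexHull_range.mpr ⟨ρ, h.nonneg, h.sum_eq, rfl⟩
  · intro ρ (h : IsBoxCoord v L ρ) ρ' (h' : IsBoxCoord v L ρ') heq
    obtain ⟨hs, hv⟩ := Prod.mk.inj heq
    exact IsPullingFace.coord_unique h.nonneg h'.nonneg h.isFace h'.isFace hs hv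
  · exact ((Set.finite_Iic _).image _).prod ((Set.finite_Iic _).biUnion fun d _ => hfin d)

/-- The multiplicities of the vertices of the face of `ρ` that raise the degree of `ρ` to `t`. -/
noncomputable def boxFiber (t : ℕ) (ρ : Fin (m + 1) → ℝ) : Finset (Fin (m + 1) →₀ ℕ) :=
  if ⌊∑ i, ρ i⌋₊ ≤ t then (insert 0 (tailSupport ρ)).finsuppAntidiag (t - ⌊∑ i, ρ i⌋₊) else ∅

theorem mem_boxFiber {t : ℕ} {ν : Fin (m + 1) →₀ ℕ} : ν ∈ boxFiber t ρ ↔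
    ⌊∑ i, ρ i⌋₊ + ∑ i, ν i = t ∧ ∀ i ≠ 0, ρ i = 0 → ν i = 0 := by
  have hsupp : ν.support ⊆ insert 0 (tailSupport ρ) ↔ ∀ i ≠ 0, ρ i = 0 → ν i = 0 := by
    constructor
    · intro h i hi hρ
      by_contra hne
      have := h (Finsupp.mem_support_iff.mpr hne)
      simp_all [tailSupport]
    · intro h i hi
      have := h i
      simp_all [tailSupport]
      tauto
  unfold boxFiber
  split_ifs with hd
  · rw [Finset.mem_finsuppAntidiag', Finsupp.sum_fintype _ _ (fun _ => rfl), hsupp]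
    refine and_congr_left fun _ => ?_
    omega
  · simp only [Finset.notMem_empty, false_iff, not_and]
    intro h
    omega

/-- Stars and bars. When `t` is smaller than the degree of `ρ` the binomial coefficient vanishes,
so one polynomial gives the count for all `t`. -/
theorem IsBoxCoord.card_boxFiber (h : IsBoxCoord v L ρ) (t : ℕ) : (boxFiber t ρ).card =
    (t + ((tailSupport ρ).card - ⌊∑ i, ρ i⌋₊)).choose (tailSupport ρ).card := by
  have hd := h.degree_le
  unfold boxFiber
  split_ifs with ht
  · rw [Finset.card_finsuppAntidiag_nat_eq_choose,
      Finset.card_insert_of_notMem (by simp [tailSupport])]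
    generalize (tailSupport ρ).card = s at *
    generalize ⌊∑ i, ρ i⌋₊ = d at *
    rw [show s + 1 + (t - d) - 1 = s + (t - d) by omega,
      show t + (s - d) = s + (t - d) by omega, Nat.choose_symm_add]
  · rw [Nat.choose_eq_zero_of_lt (by omega), Finset.card_empty]

/-- The lattice point with box part `ρ` and multiplicities `ν`. -/
noncomputable def boxPoint (v : Fin (m + 1) → V) (q : Σ _ : Fin (m + 1) → ℝ, Fin (m + 1) →₀ ℕ) :
    V :=
  ∑ i, (q.1 i + q.2 i) • v i

theorem IsBoxCoord.isPullingFace_add (h : IsBoxCoord v L ρ) {ν : Fin (m + 1) →₀ ℕ}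
    (hν : ∀ i ≠ 0, ρ i = 0 → ν i = 0) :
    IsPullingFace v (Function.support fun i => ρ i + ν i) := by
  refine h.isFace.insert_zero.mono fun i hi => ?_
  by_contra hcon
  simp only [Set.mem_insert_iff, Function.mem_support, not_or, not_not] at hcon
  simp [hcon.2, hν i hcon.1 hcon.2] at hi

/-- Different choices of `ρ` and `ν` represent different lattice points. -/
theorem boxPoint_injOn (B : Finset (Fin (m + 1) → ℝ)) (hB : ∀ ρ ∈ B, IsBoxCoord v L ρ) (t : ℕ) :
    Set.InjOn (boxPoint v) (B.sigma (boxFiber t) : Set (Σ _ : Fin (m + 1) → ℝ, _)) := by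
  rintro ⟨ρ, ν⟩ h ⟨ρ', ν'⟩ h' heq
  simp only [Finset.coe_sigma, Set.mem_sigma_iff, Finset.mem_coe, mem_boxFiber] at h h'
  obtain ⟨hρ, hs, hν⟩ := h
  obtain ⟨hρ', hs', hν'⟩ := h'
  have hρ := hB _ hρ
  have hρ' := hB _ hρ'
  have hcoord : (fun i => ρ i + (ν i : ℝ)) = fun i => ρ' i + (ν' i : ℝ) := by
    refine IsPullingFace.coord_unique (v := v) (fun i => add_nonneg (hρ.nonneg i) (by positivity))
      (fun i => add_nonneg (hρ'.nonneg i) (by positivity)) (hρ.isPullingFace_add hν)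
      (hρ'.isPullingFace_add hν') ?_ heq
    simp only [Finset.sum_add_distrib]
    rw [hρ.sum_eq, hρ'.sum_eq]
    exact_mod_cast hs.trans hs'.symm
  have hi : ∀ i, ρ i = ρ' i ∧ ν i = ν' i := by
    intro i
    have hci := congrFun hcoord i
    by_cases h0 : i = 0
    · subst h0
      have hfl := congrArg Nat.floor hci
      rw [Nat.floor_add_natCast (hρ.nonneg 0), Nat.floor_add_natCast (hρ'.nonneg 0),
        Nat.floor_eq_zero.mpr hρ.zero_lt_one, Nat.floor_eq_zero.mpr hρ'.zero_lt_one] at hfl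
      have hν0 : ν 0 = ν' 0 := by omega
      rw [hν0] at hci
      exact ⟨by linarith, hν0⟩
    · exact eq_and_eq_of_add_natCast_eq (hρ.nonneg i) (hρ.le_one i) (hρ'.nonneg i) (hρ'.le_one i)
        (hν i h0) (hν' i h0) hci
  obtain rfl : ρ = ρ' := funext fun i => (hi i).1
  obtain rfl : ν = ν' := Finsupp.ext fun i => (hi i).2
  rfl

/-- Every lattice point of the dilate by `t` splits into a box part and multiplicities. -/
theorem image_boxPoint (hv : ∀ i, v i ∈ L) (B : Finset (Fin (m + 1) → ℝ))
    (hB : ∀ ρ, ρ ∈ B ↔ IsBoxCoord v L ρ) (t : ℕ) :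
    boxPoint v '' (B.sigma (boxFiber t) : Set (Σ _ : Fin (m + 1) → ℝ, _)) =
      (t : ℝ) • convexHull ℝ (Set.range v) ∩ (L : Set V) := by
  have hsmul : ∀ ν : Fin (m + 1) → ℕ, ∑ i, (ν i : ℝ) • v i ∈ L := fun ν =>
    Submodule.sum_mem _ fun i _ => by
      rw [Nat.cast_smul_eq_nsmul]
      exact nsmul_mem (hv i) _
  ext x
  constructor
  · rintro ⟨⟨ρ, ν⟩, h, rfl⟩
    simp only [Finset.coe_sigma, Set.mem_sigma_iff, Finset.mem_coe, mem_boxFiber] at h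
    obtain ⟨hρ, hs, hν⟩ := h
    have hρ := (hB _).mp hρ
    refine ⟨mem_smul_convexHull_range.mpr ⟨fun i => ρ i + ν i,
      fun i => add_nonneg (hρ.nonneg i) (by positivity), ?_, rfl⟩, ?_⟩
    · rw [Finset.sum_add_distrib, hρ.sum_eq]
      exact_mod_cast hs
    · simp only [boxPoint, add_smul, Finset.sum_add_distrib]
      exact add_mem hρ.mem (hsmul _)
  · rintro ⟨hx, hxL⟩
    obtain ⟨μ, hμ0, hμs, rfl⟩ := mem_smul_convexHull_range.mp hx
    obtain ⟨l, hl0, hls, hlv, hface⟩ := exists_isPullingFace_support (v := v) hμ0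
    -- At the apex split off the integer part; elsewhere leave a remainder in `(0, 1]`.
    -- Truncated subtraction gives `ν i = 0` when `l i = 0`.
    let ν : Fin (m + 1) →₀ ℕ :=
      Finsupp.equivFunOnFinite.symm fun i => if i = 0 then ⌊l i⌋₊ else ⌈l i⌉₊ - 1
    let ρ : Fin (m + 1) → ℝ := fun i => l i - ν i
    have hν0 : ν 0 = ⌊l 0⌋₊ := by simp [ν]
    have hνi : ∀ i ≠ 0, ν i = ⌈l i⌉₊ - 1 := fun i hi => by simp [ν, hi]
    have hcase : ∀ i ≠ 0, (l i = 0 ∧ ρ i = 0 ∧ ν i = 0) ∨ (0 < ρ i ∧ ρ i ≤ 1) := by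
      intro i hi
      rcases (hl0 i).eq_or_lt with h | h
      · have hli : l i = 0 := h.symm
        exact .inl ⟨hli, by simp [ρ, hνi i hi, hli], by simp [hνi i hi, hli]⟩
      · right
        have hc : 1 ≤ ⌈l i⌉₊ := Nat.one_le_ceil_iff.mpr h
        have h1 := Nat.ceil_lt_add_one (hl0 i)
        have h2 := Nat.le_ceil (l i)
        simp only [ρ, hνi i hi]
        rw [Nat.cast_sub hc]
        constructor <;> push_cast <;> linarith
    have hρ0 : 0 ≤ ρ 0 ∧ ρ 0 < 1 := by
      have h1 := Nat.floor_le (hl0 0)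
      have h2 := Nat.lt_floor_add_one (l 0)
      simp only [ρ, hν0] at *
      constructor <;> linarith
    have hρnn : 0 ≤ ρ := fun i => by
      by_cases hi : i = 0
      · rw [hi]
        exact hρ0.1
      · rcases hcase i hi with h | h
        · exact h.2.1.ge
        · exact h.1.le
    have hsum : ∑ i, ρ i = t - (∑ i, ν i : ℕ) := by
      push_cast
      rw [Finset.sum_sub_distrib, hls, hμs]
    have hle : ∑ i, ν i ≤ t := by
      have := Finset.sum_nonneg fun i (_ : i ∈ Finset.univ) => hρnn i
      rw [hsum] at this
      exact_mod_cast sub_nonneg.mp this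
    have hfloor : ⌊∑ i, ρ i⌋₊ = t - ∑ i, ν i := by
      rw [hsum, ← Nat.cast_sub hle, Nat.floor_natCast]
    have hbox : IsBoxCoord v L ρ := by
      refine ⟨hρnn, hface.mono fun i hi => ?_, ?_, hρ0.2, fun i => ?_, ?_⟩
      · by_contra h
        have hli : l i = 0 := by simpa using h
        by_cases h0 : i = 0
        · subst h0
          simp [ρ, hν0, hli] at hi
        · simp [ρ, hνi i h0, hli] at hi
      · simp only [ρ, sub_smul, Finset.sum_sub_distrib, hlv]
        exact sub_mem hxL (hsmul _)
      · by_cases hi : i = 0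
        · rw [hi]
          exact hρ0.2.le
        · rcases hcase i hi with h | h
          · rw [h.2.1]
            exact zero_le_one
          · exact h.2
      · rw [hfloor, hsum, Nat.cast_sub hle]
    refine ⟨⟨ρ, ν⟩, ?_, ?_⟩
    · simp only [Finset.coe_sigma, Set.mem_sigma_iff, Finset.mem_coe, mem_boxFiber]
      refine ⟨(hB _).mpr hbox, by omega, fun i hi hρi => ?_⟩
      rcases hcase i hi with h | h
      · exact h.2.2
      · exact absurd hρi h.1.ne'
    · simp only [boxPoint, ρ, sub_add_cancel]
      exact hlv

/-- **Ehrhart's theorem** for the convex hull of finitely many lattice points. -/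
theorem exists_isEhrhartPolynomial_convexHull (hv : ∀ i, v i ∈ L)
    (hfin : ∀ t : ℕ, ((t : ℝ) • convexHull ℝ (Set.range v) ∩ (L : Set V)).Finite) :
    ∃ q : ℚ[X], IsEhrhartPolynomial L (convexHull ℝ (Set.range v)) q := by
  classical
  let B := (finite_setOf_isBoxCoord hfin).toFinset
  have hB : ∀ ρ, ρ ∈ B ↔ IsBoxCoord v L ρ := fun ρ => by simp [B]
  choose q hq using exists_eval_eq_choose
  refine ⟨∑ ρ ∈ B, q ((tailSupport ρ).card - ⌊∑ i, ρ i⌋₊) (tailSupport ρ).card,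
    fun t => ⟨hfin t, ?_⟩⟩
  rw [latticePointCount, ← image_boxPoint hv B hB t,
    (boxPoint_injOn B (fun ρ h => (hB ρ).mp h) t).ncard_image, Set.ncard_coe_finset,
    Finset.card_sigma, eval_finsetSum]
  push_cast
  refine Finset.sum_congr rfl fun ρ hρ => ?_
  rw [hq, ((hB ρ).mp hρ).card_boxFiber]

end Counting

/-! ### Volume and the leading coefficient -/

section Polytope

variable {V : Type*} [NormedAddCommGroup V] [NormedSpace ℝ V] {L M : Submodule ℤ V} {P : Set V}

theorem IsLatticePolytope.mono (hP : IsLatticePolytope L P) (h : L ≤ M) : IsLatticePolytope M P :=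
  ⟨hP.polytope, hP.vertices.trans h, hP.full_dim⟩

theorem IsLatticePolytope.isCompact (hP : IsLatticePolytope L P) : IsCompact P := by
  obtain ⟨s, rfl⟩ := hP.polytope
  exact s.finite_toSet.isCompact_convexHull ℝ

theorem IsLatticePolytope.convex (hP : IsLatticePolytope L P) : Convex ℝ P := by
  obtain ⟨s, rfl⟩ := hP.polytope
  exact convex_convexHull ℝ _

theorem IsLatticePolytope.nonempty (hP : IsLatticePolytope L P) : P.Nonempty := by
  rw [← affineSpan_nonempty (k := ℝ), hP.full_dim]
  exact ⟨0, trivial⟩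

theorem IsLatticePolytope.exists_eq_convexHull_range (hP : IsLatticePolytope L P) :
    ∃ (m : ℕ) (v : Fin (m + 1) → V), (∀ i, v i ∈ L) ∧ P = convexHull ℝ (Set.range v) := by
  obtain ⟨s, hs⟩ := hP.polytope
  have hfin : (P.extremePoints ℝ).Finite :=
    s.finite_toSet.subset (hs ▸ extremePoints_convexHull_subset (𝕜 := ℝ))
  have hull : P = convexHull ℝ (P.extremePoints ℝ) := by
    rw [← (hfin.isClosed_convexHull ℝ).closure_eq,
      closure_convexHull_extremePoints hP.isCompact hP.convex]
  have hne : (P.extremePoints ℝ).Nonempty := by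
    rw [← convexHull_nonempty_iff (𝕜 := ℝ), ← hull]
    exact hP.nonempty
  obtain ⟨k, v, -, hv⟩ := hfin.fin_param
  obtain _ | m := k
  · simp [← hv] at hne
  · exact ⟨m, v, fun i => hP.vertices (hv ▸ Set.mem_range_self i), by rwa [hv]⟩

theorem IsLattice.finite_inter (hM : IsLattice M) [FiniteDimensional ℝ V] {K : Set V}
    (hK : Bornology.IsBounded K) : (K ∩ (M : Set V)).Finite := by
  obtain ⟨_, _⟩ := hM
  have : IsClosed (M : Set V) := AddSubgroup.isClosed_of_discrete (H := M.toAddSubgroup)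
  exact Metric.finite_isBounded_inter_isClosed ⟨inferInstanceAs (DiscreteTopology M)⟩ hK this

theorem IsLatticePolytope.exists_isEhrhartPolynomial [FiniteDimensional ℝ V]
    (hP : IsLatticePolytope M P) (hM : IsLattice M) : ∃ q : ℚ[X], IsEhrhartPolynomial M P q := by
  have hfin : ∀ t : ℕ, ((t : ℝ) • P ∩ (M : Set V)).Finite := fun t =>
    hM.finite_inter (hP.isCompact.smul (t : ℝ)).isBounded
  obtain ⟨m, v, hv, rfl⟩ := hP.exists_eq_convexHull_range
  exact exists_isEhrhartPolynomial_convexHull hv hfin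

theorem IsLatticePolytope.isEhrhartPolynomial [FiniteDimensional ℝ V]
    (hP : IsLatticePolytope M P) (hM : IsLattice M) :
    IsEhrhartPolynomial M P (ehrhartPolynomial M P) := by
  obtain ⟨q, hq⟩ := hP.exists_isEhrhartPolynomial hM
  rwa [hq.eq_ehrhartPolynomial]

theorem IsLatticePolytope.coeff_zero_ehrhartPolynomial [FiniteDimensional ℝ V]
    (hP : IsLatticePolytope M P) (hM : IsLattice M) : (ehrhartPolynomial M P).coeff 0 = 1 := by
  have h := (hP.isEhrhartPolynomial hM 0).2
  rw [Nat.cast_zero, ← coeff_zero_eq_eval_zero] at h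
  rw [h, latticePointCount, Nat.cast_zero, Set.zero_smul_set hP.nonempty,
    Set.inter_eq_left.mpr (by simp)]
  exact_mod_cast Set.ncard_singleton (0 : V)

/-- The Ehrhart polynomial as a real polynomial. -/
noncomputable abbrev realEhrhart (M : Submodule ℤ V) (P : Set V) : ℝ[X] :=
  (ehrhartPolynomial M P).map (algebraMap ℚ ℝ)

theorem IsLatticePolytope.eval_realEhrhart [FiniteDimensional ℝ V]
    (hP : IsLatticePolytope M P) (hM : IsLattice M) (t : ℕ) :
    (realEhrhart M P).eval (t : ℝ) = latticePointCount M P t := by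
  have h := (hP.isEhrhartPolynomial hM t).2
  rw [realEhrhart, ← map_natCast (algebraMap ℚ ℝ) t, eval_map_algebraMap, aeval_algebraMap_apply]
  simp [h]

variable [FiniteDimensional ℝ V] [MeasurableSpace V] [BorelSpace V]

/-- In coordinates with respect to a basis of the lattice, the Lebesgue measure is the Haar
measure normalized by the lattice. -/
theorem volume_real_image_equivFun [DiscreteTopology M] [IsZLattice ℝ M] {ι : Type*} [Fintype ι]
    (b : Module.Basis ι ℤ M) (P : Set V) :
    volume.real ((b.ofZLatticeBasis ℝ M).equivFun '' P) = latticeVolume M P := by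
  set μ : Measure V := Measure.addHaar
  let e : V ≃L[ℝ] (ι → ℝ) := (b.ofZLatticeBasis ℝ M).equivFunL
  have himg : ∀ s : Set V, μ.map e (e '' s) = μ s := fun s => by
    refine (e.toHomeomorph.toMeasurableEquiv.map_apply (e '' s)).trans ?_
    exact congrArg μ (e.injective.preimage_image s)
  have : (μ.map e).IsAddHaarMeasure := e.isAddHaarMeasure_map μ
  have hsmul := Measure.isAddLeftInvariant_eq_smul (μ.map e) (volume : Measure (ι → ℝ))
  set c := (μ.map e).addHaarScalarFactor volume
  have hreal : ∀ s : Set V, μ.real s = c * volume.real (e '' s) := fun s => by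
    rw [measureReal_def, ← himg s, hsmul]
    simp [measureReal_def]
  -- The coordinates map a fundamental domain onto the half-open unit cube.
  have hcov : ZLattice.covolume M μ = c := by
    rw [ZLattice.covolume_eq_measure_fundamentalDomain M μ (ZLattice.isAddFundamentalDomain b μ),
      hreal]
    have : e '' ZSpan.fundamentalDomain (b.ofZLatticeBasis ℝ M) =
        Set.pi Set.univ fun _ => Set.Ico (0 : ℝ) 1 := by
      ext x
      constructor
      · rintro ⟨y, hy, rfl⟩ i -
        exact hy i
      · intro hx
        refine ⟨e.symm x, fun i => ?_, e.apply_symm_apply x⟩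
        have : (b.ofZLatticeBasis ℝ M).repr (e.symm x) i = x i :=
          congrFun (e.apply_symm_apply x) i
        rw [this]
        exact hx i trivial
    rw [this, measureReal_def, volume_pi_pi]
    simp
  have hc : (c : ℝ) ≠ 0 := hcov ▸ ZLattice.covolume_ne_zero M μ
  rw [latticeVolume, hreal P, hcov, mul_div_cancel_left₀ _ hc]
  rfl

/-- The number of lattice points in a large dilate is asymptotic to its volume. -/
theorem IsLatticePolytope.tendsto_latticePointCount_div_pow (hP : IsLatticePolytope M P)
    (hM : IsLattice M) :
    Tendsto (fun t : ℕ => (latticePointCount M P t : ℝ) / (t : ℝ) ^ Module.finrank ℝ V) atTop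
      (𝓝 (latticeVolume M P)) := by
  obtain ⟨_, _⟩ := hM
  let b := Module.finBasis ℤ M
  have hconv : Convex ℝ ((b.ofZLatticeBasis ℝ M).equivFun '' P) :=
    hP.convex.linear_image (b.ofZLatticeBasis ℝ M).equivFun.toLinearMap
  have h := ZLattice.covolume.tendsto_card_div_pow'' b hP.isCompact.isBounded
    hP.isCompact.measurableSet (hconv.addHaar_frontier volume)
  rw [volume_real_image_equivFun, ← Module.finrank_eq_card_basis b, ZLattice.rank ℝ M] at h
  refine h.congr' ?_
  filter_upwards [eventually_gt_atTop 0] with t ht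
  have ht' : (t : ℝ) ≠ 0 := by positivity
  congr 2
  rw [Nat.card_coe_set_eq, latticePointCount,
    ← Set.ncard_image_of_injective _ (smul_right_injective V ht'), Set.image_smul,
    Set.smul_set_inter₀ ht', smul_inv_smul₀ ht']

/-- A polynomial that grows like `c * t ^ n` along the natural numbers has degree at most `n`, and
its coefficient of `X ^ n` is `c`. -/
theorem natDegree_le_and_coeff_eq_of_tendsto {q : ℝ[X]} {n : ℕ} {c : ℝ}
    (h : Tendsto (fun t : ℕ => q.eval (t : ℝ) / (t : ℝ) ^ n) atTop (𝓝 c)) :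
    q.natDegree ≤ n ∧ q.coeff n = c := by
  have hX : ∀ x : ℝ, (X ^ n : ℝ[X]).eval x = x ^ n := fun x => by simp
  rcases lt_trichotomy q.degree (n : WithBot ℕ) with hd | hd | hd
  · have := (div_tendsto_atTop_zero_of_degree_lt q (X ^ n) (by simpa using hd)).comp
      tendsto_natCast_atTop_atTop
    simp only [Function.comp_def, hX] at this
    exact ⟨natDegree_le_of_degree_le hd.le,
      (coeff_eq_zero_of_degree_lt hd).trans (tendsto_nhds_unique this h)⟩
  · have := (div_tendsto_atTop_leadingCoeff_div_of_degree_eq q (X ^ n) (by simpa using hd)).comp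
      tendsto_natCast_atTop_atTop
    simp only [Function.comp_def, hX, leadingCoeff_X_pow, div_one] at this
    have hn := natDegree_eq_of_degree_eq_some hd
    refine ⟨hn.le, ?_⟩
    rw [← tendsto_nhds_unique this h, leadingCoeff, hn]
  · have := (abs_div_tendsto_atTop_atTop_of_degree_gt q (X ^ n) (by simpa using hd)
      (pow_ne_zero _ X_ne_zero)).comp tendsto_natCast_atTop_atTop
    simp only [Function.comp_def, hX] at this
    exact absurd h.abs (not_tendsto_nhds_of_tendsto_atTop this _)

theorem IsLatticePolytope.realEhrhart_natDegree_le (hP : IsLatticePolytope M P)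
    (hM : IsLattice M) : (realEhrhart M P).natDegree ≤ Module.finrank ℝ V := by
  refine (natDegree_le_and_coeff_eq_of_tendsto (c := latticeVolume M P) ?_).1
  simpa only [hP.eval_realEhrhart hM] using hP.tendsto_latticePointCount_div_pow hM

theorem IsLatticePolytope.realEhrhart_coeff_finrank (hP : IsLatticePolytope M P)
    (hM : IsLattice M) : (realEhrhart M P).coeff (Module.finrank ℝ V) = latticeVolume M P := by
  refine (natDegree_le_and_coeff_eq_of_tendsto (c := latticeVolume M P) ?_).2
  simpa only [hP.eval_realEhrhart hM] using hP.tendsto_latticePointCount_div_pow hM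

/-- The covolume is multiplied by the index on passing to a sublattice, for any Haar measure. -/
theorem covolume_eq_relIndex_mul_covolume (hL : IsLattice L) (hM : IsLattice M) (h : L ≤ M)
    (μ : Measure V) [μ.IsAddHaarMeasure] : ZLattice.covolume L μ =
      L.toAddSubgroup.relIndex M.toAddSubgroup * ZLattice.covolume M μ := by
  classical
  obtain ⟨_, _⟩ := hL
  obtain ⟨_, _⟩ := hM
  have hcard : Module.finrank ℤ L = Module.finrank ℤ M := by
    rw [ZLattice.rank ℝ L, ZLattice.rank ℝ M]
  let b₁ := (Module.finBasis ℤ L).reindex (finCongr hcard)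
  let b₂ := Module.finBasis ℤ M
  have hidx : L.toAddSubgroup.relIndex M.toAddSubgroup =
      (b₂.det fun i => (⟨b₁ i, h (b₁ i).2⟩ : M)).natAbs :=
    AddSubgroup.relIndex_eq_natAbs_det L.toAddSubgroup M.toAddSubgroup h b₁ b₂
  rw [ZLattice.covolume_eq_det_mul_measureReal L μ b₁ (b₂.ofZLatticeBasis ℝ M),
    ZLattice.covolume_eq_measure_fundamentalDomain M μ (ZLattice.isAddFundamentalDomain b₂ μ),
    hidx, Nat.cast_natAbs, Int.cast_abs, Module.Basis.det_apply, Module.Basis.det_apply,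
    Int.cast_det]
  congr 3
  ext i j
  rw [Matrix.map_apply, Module.Basis.toMatrix_apply, Module.Basis.toMatrix_apply]
  exact b₂.ofZLatticeBasis_repr_apply ℝ M ⟨b₁ j, h (b₁ j).2⟩ i

theorem latticeVolume_eq_relIndex_mul (hL : IsLattice L) (hM : IsLattice M) (h : L ≤ M)
    (P : Set V) :
    latticeVolume M P = L.toAddSubgroup.relIndex M.toAddSubgroup * latticeVolume L P := by
  have hc := covolume_eq_relIndex_mul_covolume hL hM h (Measure.addHaar : Measure V)
  have hne : ZLattice.covolume L (Measure.addHaar : Measure V) ≠ 0 := by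
    obtain ⟨_, _⟩ := hL
    exact ZLattice.covolume_ne_zero L _
  rw [hc] at hne
  have h1 := left_ne_zero_of_mul hne
  have h2 := right_ne_zero_of_mul hne
  rw [latticeVolume, latticeVolume, hc]
  field_simp

theorem IsLatticePolytope.latticeVolume_pos (hP : IsLatticePolytope L P) (hL : IsLattice L) :
    0 < latticeVolume L P := by
  obtain ⟨_, _⟩ := hL
  refine div_pos ?_ (ZLattice.covolume_pos L _)
  have hint : (interior P).Nonempty :=
    hP.convex.interior_nonempty_iff_affineSpan_eq_top.mpr hP.full_dim
  exact ENNReal.toReal_pos (Measure.measure_pos_of_nonempty_interior _ hint).ne'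
    hP.isCompact.measure_lt_top.ne

end Polytope

/-! ### Superlattices of prime coindex -/

section Superlattices

variable {V : Type*} [NormedAddCommGroup V] [NormedSpace ℝ V] {L M : Submodule ℤ V} {P : Set V}
  {p : ℕ}

/-- The lattice `p⁻¹ L`. -/
noncomputable def divLattice (L : Submodule ℤ V) (p : ℕ) : Submodule ℤ V :=
  ZLattice.comap ℝ L ((p : ℝ) • LinearMap.id)

theorem mem_divLattice {x : V} : x ∈ divLattice L p ↔ (p : ℝ) • x ∈ L := Iff.rfl

theorem le_divLattice : L ≤ divLattice L p := fun x hx => by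
  rw [mem_divLattice, Nat.cast_smul_eq_nsmul]
  exact nsmul_mem hx p

theorem IsLattice.of_le_of_le_divLattice (hL : IsLattice L) (hp : p ≠ 0) (h : L ≤ M)
    (h' : M ≤ divLattice L p) : IsLattice M := by
  obtain ⟨_, hspan⟩ := hL
  have hp' : (p : ℝ) ≠ 0 := by exact_mod_cast hp
  have : DiscreteTopology (divLattice L p) :=
    ZLattice.comap_discreteTopology ℝ L (e := (p : ℝ) • LinearMap.id)
      (continuous_const_smul (p : ℝ)) (smul_right_injective V hp')
  have : DiscreteTopology M := DiscreteTopology.of_subset this h'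
  refine ⟨this, ⟨?_⟩⟩
  rw [eq_top_iff, ← hspan.span_top]
  exact Submodule.span_mono h

theorem le_divLattice_of_mem_superlattices (hM : M ∈ superlattices L p) : M ≤ divLattice L p := by
  intro x hx
  have := (L.toAddSubgroup.addSubgroupOf M.toAddSubgroup).nsmul_index_mem ⟨x, hx⟩
  rw [mem_divLattice, Nat.cast_smul_eq_nsmul, ← hM.2.2]
  exact this

/-- The quotient of `L + ℤ x` by `L` is cyclic, generated by the class of `x`, which has order
`p`. -/
theorem relIndex_sup_span_singleton (hp : p.Prime) {x : V} (hx : x ∈ divLattice L p)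
    (hxL : x ∉ L) :
    L.toAddSubgroup.relIndex (L ⊔ Submodule.span ℤ {x}).toAddSubgroup = p := by
  have : Fact p.Prime := ⟨hp⟩
  have hsup : (L ⊔ Submodule.span ℤ {x}).toAddSubgroup =
      L.toAddSubgroup ⊔ AddSubgroup.zmultiples x := by
    rw [Submodule.sup_toAddSubgroup, Submodule.span_singleton_toAddSubgroup_eq_zmultiples]
  let f := QuotientAddGroup.mk' L.toAddSubgroup
  have hf : ∀ y, f y = 0 ↔ y ∈ L := fun y => QuotientAddGroup.eq_zero_iff y
  have hker : f.ker = L.toAddSubgroup := QuotientAddGroup.ker_mk' _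
  have horder : addOrderOf (f x) = p := by
    refine addOrderOf_eq_prime ?_ (by rwa [Ne, hf])
    rw [← map_nsmul, hf, ← Nat.cast_smul_eq_nsmul ℝ]
    exact hx
  rw [hsup, sup_comm, AddSubgroup.relIndex_sup_right, ← hker, AddSubgroup.relIndex_ker,
    AddMonoidHom.map_zmultiples, Nat.card_zmultiples, horder]

theorem sup_span_singleton_mem_superlattices (hL : IsLattice L) (hp : p.Prime) {x : V}
    (hx : x ∈ divLattice L p) (hxL : x ∉ L) : L ⊔ Submodule.span ℤ {x} ∈ superlattices L p :=
  ⟨hL.of_le_of_le_divLattice hp.ne_zero le_sup_left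
    (sup_le le_divLattice (by simpa [Submodule.span_le] using hx)), le_sup_left,
    relIndex_sup_span_singleton hp hx hxL⟩

/-- As `p` is prime, a superlattice of coindex `p` is generated over `L` by any of its points
outside `L`. -/
theorem eq_sup_span_singleton_of_mem_superlattices (hp : p.Prime) (hM : M ∈ superlattices L p)
    {x : V} (hx : x ∈ M) (hxL : x ∉ L) : M = L ⊔ Submodule.span ℤ {x} := by
  have hle : L ⊔ Submodule.span ℤ {x} ≤ M :=
    sup_le hM.2.1 (by simpa [Submodule.span_le] using hx)
  refine le_antisymm ?_ hle
  have hmul := AddSubgroup.relIndex_mul_relIndex L.toAddSubgroup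
    (L ⊔ Submodule.span ℤ {x}).toAddSubgroup M.toAddSubgroup
    (show L ≤ L ⊔ Submodule.span ℤ {x} from le_sup_left) hle
  rw [relIndex_sup_span_singleton hp (le_divLattice_of_mem_superlattices hM hx) hxL, hM.2.2] at hmul
  exact AddSubgroup.relIndex_eq_one.mp (Nat.eq_of_mul_eq_mul_left hp.pos (by simpa using hmul))

/-- Multiplication by `p` maps the points of `tP` in `p⁻¹ L` onto the points of `ptP` in `L`. -/
theorem latticePointCount_divLattice (hp : p ≠ 0) (t : ℕ) :
    latticePointCount (divLattice L p) P t = latticePointCount L P (p * t) := by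
  have hp' : (p : ℝ) ≠ 0 := by exact_mod_cast hp
  rw [latticePointCount, latticePointCount,
    ← Set.ncard_image_of_injective _ (smul_right_injective V hp')]
  congr 1
  ext x
  rw [Set.image_smul, Set.smul_set_inter₀ hp', smul_smul, Nat.cast_mul]
  refine and_congr_right fun _ => ?_
  rw [Set.mem_smul_set_iff_inv_smul_mem₀ hp', SetLike.mem_coe, mem_divLattice, smul_inv_smul₀ hp']
  rfl

variable [FiniteDimensional ℝ V]

/-- A superlattice is generated over `L` by a point of `p⁻¹ L` in a fundamental domain of `L`, and
there are finitely many such points. -/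
theorem finite_superlattices (hL : IsLattice L) (hp : p.Prime) : (superlattices L p).Finite := by
  have hdiv := hL.of_le_of_le_divLattice hp.ne_zero le_divLattice (le_refl (divLattice L p))
  obtain ⟨_, _⟩ := hL
  let b := (Module.finBasis ℤ L).ofZLatticeBasis ℝ L
  have hb : Submodule.span ℤ (Set.range b) = L := (Module.finBasis ℤ L).ofZLatticeBasis_span ℝ
  refine ((hdiv.finite_inter (ZSpan.fundamentalDomain_isBounded b)).image
    fun x => L ⊔ Submodule.span ℤ {x}).subset fun M hM => ?_
  obtain ⟨x, hx, hxL⟩ : ∃ x ∈ M, x ∉ L := by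
    by_contra! h
    exact hp.ne_one (hM.2.2 ▸ AddSubgroup.relIndex_eq_one.mpr h)
  have hfloor : (ZSpan.floor b x : V) ∈ L := hb.le (ZSpan.floor b x).2
  have hfr : ZSpan.fract b x ∈ M := sub_mem hx (hM.2.1 hfloor)
  have hfrL : ZSpan.fract b x ∉ L := fun h => hxL (by simpa [ZSpan.fract] using add_mem h hfloor)
  exact ⟨_, ⟨ZSpan.fract_mem_fundamentalDomain b x, le_divLattice_of_mem_superlattices hM hfr⟩,
    (eq_sup_span_singleton_of_mem_superlattices hp hM hfr hfrL).symm⟩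

open Classical in
/-- Double counting: a point of `tP` in `L` lies in all superlattices, a point of `tP` in `p⁻¹ L`
outside `L` lies in exactly one of them. -/
theorem sum_latticePointCount_superlattices (hP : IsCompact P) (hL : IsLattice L) (hp : p.Prime)
    (t : ℕ) :
    ∑ M ∈ (finite_superlattices hL hp).toFinset, latticePointCount M P t +
        latticePointCount L P t =
      (superlattices L p).ncard * latticePointCount L P t + latticePointCount L P (p * t) := by
  have hdiv := hL.of_le_of_le_divLattice hp.ne_zero le_divLattice (le_refl (divLattice L p))
  have hF := hdiv.finite_inter (hP.smul (t : ℝ)).isBounded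
  set F := hF.toFinset
  set S := (finite_superlattices hL hp).toFinset
  have hcount : ∀ M ≤ divLattice L p,
      latticePointCount M P t = (F.filter (· ∈ M)).card := fun M hM => by
    rw [latticePointCount, ← Set.ncard_coe_finset]
    congr 1
    ext x
    simp only [F, Set.mem_inter_iff, SetLike.mem_coe, Finset.coe_filter, Set.Finite.mem_toFinset]
    exact ⟨fun h => ⟨⟨h.1, hM h.2⟩, h.2⟩, fun h => ⟨h.1.1, h.2⟩⟩
  have hmem : ∀ x ∈ F, (S.filter (x ∈ ·)).card = if x ∈ L then S.card else 1 := by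
    intro x hx
    have hxd : x ∈ divLattice L p := by
      simp only [F, Set.Finite.mem_toFinset] at hx
      exact hx.2
    split_ifs with hxL
    · rw [Finset.filter_true_of_mem]
      intro M hM
      exact ((finite_superlattices hL hp).mem_toFinset.mp hM).2.1 hxL
    · rw [Finset.card_eq_one]
      refine ⟨L ⊔ Submodule.span ℤ {x}, ?_⟩
      ext M
      simp only [S, Finset.mem_filter, Set.Finite.mem_toFinset, Finset.mem_singleton]
      constructor
      · rintro ⟨hM, hxM⟩
        exact eq_sup_span_singleton_of_mem_superlattices hp hM hxM hxL
      · rintro rfl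
        exact ⟨sup_span_singleton_mem_superlattices hL hp hxd hxL,
          Submodule.mem_sup_right (Submodule.mem_span_singleton_self x)⟩
  have hsum : ∑ M ∈ S, latticePointCount M P t =
      ∑ x ∈ F, if x ∈ L then S.card else 1 := by
    rw [← Finset.sum_congr rfl hmem]
    refine (Finset.sum_congr rfl fun M hM => hcount M ?_).trans
      (Finset.sum_card_bipartiteAbove_eq_sum_card_bipartiteBelow fun M x => x ∈ M)
    exact le_divLattice_of_mem_superlattices ((finite_superlattices hL hp).mem_toFinset.mp hM)
  have hcardF : latticePointCount L P (p * t) = F.card := by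
    rw [← latticePointCount_divLattice hp.ne_zero, hcount _ le_rfl, Finset.filter_true_of_mem]
    intro x hx
    simp only [F, Set.Finite.mem_toFinset] at hx
    exact hx.2
  rw [hsum, hcardF, hcount L le_divLattice,
    Set.ncard_eq_toFinset_card _ (finite_superlattices hL hp),
    Finset.sum_ite, ← Finset.card_filter_add_card_filter_not (s := F) (· ∈ L)]
  simp only [Finset.sum_const, smul_eq_mul, mul_one, S]
  ring

/-- The double count, read off coefficientwise. -/
theorem sum_coeff_realEhrhart_superlattices (hP : IsLatticePolytope L P) (hL : IsLattice L)
    (hp : p.Prime) (l : ℕ) :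
    ∑ M ∈ (finite_superlattices hL hp).toFinset, (realEhrhart M P).coeff l =
      ((superlattices L p).ncard + (p : ℝ) ^ l - 1) * (realEhrhart L P).coeff l := by
  have hpoly : ∑ M ∈ (finite_superlattices hL hp).toFinset, realEhrhart M P + realEhrhart L P =
      C ((superlattices L p).ncard : ℝ) * realEhrhart L P +
        (realEhrhart L P).comp (C (p : ℝ) * X) := by
    refine Polynomial.eq_of_infinite_eval_eq _ _
      ((Set.infinite_range_of_injective (Nat.cast_injective (R := ℝ))).mono ?_)
    rintro _ ⟨t, rfl⟩
    have h : ∀ M ∈ (finite_superlattices hL hp).toFinset,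
        (realEhrhart M P).eval (t : ℝ) = latticePointCount M P t := fun M hM =>
      have hM := (finite_superlattices hL hp).mem_toFinset.mp hM
      (hP.mono hM.2.1).eval_realEhrhart hM.1 t
    simp only [Set.mem_ofPred_eq, eval_add, eval_finsetSum, eval_mul, eval_C, eval_comp, eval_X]
    rw [Finset.sum_congr rfl h, ← Nat.cast_mul, hP.eval_realEhrhart hL, hP.eval_realEhrhart hL]
    exact_mod_cast sum_latticePointCount_superlattices hP.isCompact hL hp t
  have h := congrArg (coeff · l) hpoly
  simp only [coeff_add, finsetSum_coeff, coeff_C_mul, comp_C_mul_X_coeff] at h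
  linarith

variable [MeasurableSpace V] [BorelSpace V]

theorem latticeVolume_of_mem_superlattices (hL : IsLattice L) (hM : M ∈ superlattices L p) :
    latticeVolume M P = p * latticeVolume L P := by
  rw [latticeVolume_eq_relIndex_mul hL hM.1 hM.2.1, hM.2.2]

/-- The number of superlattices of coindex `p` is `(p ^ n - 1) / (p - 1)`: compare the leading
coefficients in the double count. -/
theorem ncard_superlattices_mul (hP : IsLatticePolytope L P) (hL : IsLattice L) (hp : p.Prime) :
    ((superlattices L p).ncard : ℝ) * (p - 1) = (p : ℝ) ^ Module.finrank ℝ V - 1 := by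
  have h := sum_coeff_realEhrhart_superlattices hP hL hp (Module.finrank ℝ V)
  have hsum : ∀ M ∈ (finite_superlattices hL hp).toFinset,
      (realEhrhart M P).coeff (Module.finrank ℝ V) = p * latticeVolume L P := fun M hM => by
    have hM := (finite_superlattices hL hp).mem_toFinset.mp hM
    rw [(hP.mono hM.2.1).realEhrhart_coeff_finrank hM.1, latticeVolume_of_mem_superlattices hL hM]
  rw [Finset.sum_congr rfl hsum, Finset.sum_const, nsmul_eq_mul,
    ← Set.ncard_eq_toFinset_card _ (finite_superlattices hL hp),
    hP.realEhrhart_coeff_finrank hL] at h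
  have hpos := (hP.latticeVolume_pos hL).ne'
  refine mul_right_cancel₀ hpos ?_
  linarith

theorem ncard_superlattices_pos [Nontrivial V] (hP : IsLatticePolytope L P) (hL : IsLattice L)
    (hp : p.Prime) : 0 < ((superlattices L p).ncard : ℝ) := by
  have h := ncard_superlattices_mul hP hL hp
  have hp1 : (1 : ℝ) < p := by exact_mod_cast hp.one_lt
  have hpow := one_lt_pow₀ hp1 (Module.finrank_pos (R := ℝ) (M := V)).ne'
  exact pos_of_mul_pos_left (h ▸ sub_pos.mpr hpow) (by linarith)

theorem coeff_averageRegularizedEhrhart (hL : IsLattice L) (hp : p.Prime) (l : ℕ) :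
    (averageRegularizedEhrhart (superlattices L p) P).coeff l =
      ((superlattices L p).ncard : ℝ)⁻¹ *
        (∑ M ∈ (finite_superlattices hL hp).toFinset, (realEhrhart M P).coeff l -
          if l = Module.finrank ℝ V then
            (superlattices L p).ncard * (p * latticeVolume L P) else 0) := by
  have hvol : ∀ M ∈ (finite_superlattices hL hp).toFinset,
      latticeVolume M P = p * latticeVolume L P := fun M hM =>
    latticeVolume_of_mem_superlattices hL ((finite_superlattices hL hp).mem_toFinset.mp hM)
  rw [averageRegularizedEhrhart, finsum_mem_eq_finite_toFinset_sum _ (finite_superlattices hL hp),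
    coeff_smul, finsetSum_coeff, smul_eq_mul]
  congr 1
  simp only [regularizedEhrhart, coeff_sub, coeff_C_mul, coeff_X_pow, Finset.sum_sub_distrib]
  congr 1
  split_ifs
  · simp only [mul_one]
    rw [Finset.sum_congr rfl hvol, Finset.sum_const, nsmul_eq_mul,
      ← Set.ncard_eq_toFinset_card _ (finite_superlattices hL hp)]
  · simp

theorem coeff_averageRegularizedEhrhart_of_lt [Nontrivial V] (hP : IsLatticePolytope L P)
    (hL : IsLattice L) (hp : p.Prime) {l : ℕ} (hl : l < Module.finrank ℝ V) :
    (averageRegularizedEhrhart (superlattices L p) P).coeff l =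
      (1 + ((p : ℝ) ^ l - 1) * (p - 1) / ((p : ℝ) ^ Module.finrank ℝ V - 1)) *
        (realEhrhart L P).coeff l := by
  have hN := (ncard_superlattices_pos hP hL hp).ne'
  have hp1 : (p : ℝ) - 1 ≠ 0 := sub_ne_zero.mpr (by exact_mod_cast hp.ne_one)
  rw [coeff_averageRegularizedEhrhart hL hp, sum_coeff_realEhrhart_superlattices hP hL hp,
    if_neg hl.ne, ← ncard_superlattices_mul hP hL hp]
  field_simp
  ring

theorem coeff_averageRegularizedEhrhart_of_le (hP : IsLatticePolytope L P)
    (hL : IsLattice L) (hp : p.Prime) {l : ℕ} (hl : Module.finrank ℝ V ≤ l) :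
    (averageRegularizedEhrhart (superlattices L p) P).coeff l = 0 := by
  rw [coeff_averageRegularizedEhrhart hL hp, sum_coeff_realEhrhart_superlattices hP hL hp]
  rcases hl.eq_or_lt with rfl | hlt
  · rw [if_pos rfl, hP.realEhrhart_coeff_finrank hL, add_sub_assoc,
      ← ncard_superlattices_mul hP hL hp]
    ring
  · rw [if_neg hlt.ne',
      coeff_eq_zero_of_natDegree_lt ((hP.realEhrhart_natDegree_le hL).trans_lt hlt)]
    simp

end Superlattices

theorem tendsto_pow_sub_one_mul_div {l n : ℕ} (hn : 2 ≤ n) (hl : l < n) :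
    Tendsto (fun p : ℕ => ((p : ℝ) ^ l - 1) * (p - 1) / ((p : ℝ) ^ n - 1)) atTop
      (𝓝 (if l = n - 1 then 1 else 0)) := by
  have hev : ∀ x : ℝ, ((X ^ l - C 1) * (X - C 1) : ℝ[X]).eval x / (X ^ n - C 1 : ℝ[X]).eval x =
      (x ^ l - 1) * (x - 1) / (x ^ n - 1) := fun x => by simp
  have hdn : (X ^ n - C 1 : ℝ[X]).degree = n := degree_X_pow_sub_C (by omega) 1
  have hdl : 0 < l → ((X ^ l - C 1) * (X - C 1) : ℝ[X]).degree = (l + 1 : ℕ) := fun h => by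
    rw [degree_mul, degree_X_pow_sub_C h, degree_X_sub_C]
    rfl
  split_ifs with h
  · have hd : ((X ^ l - C 1) * (X - C 1) : ℝ[X]).degree = (X ^ n - C 1 : ℝ[X]).degree := by
      rw [hdl (by omega), hdn, h, Nat.sub_add_cancel (by omega)]
    have := (div_tendsto_atTop_leadingCoeff_div_of_degree_eq _ _ hd).comp
      (tendsto_natCast_atTop_atTop (R := ℝ))
    simpa only [Function.comp_def, hev, leadingCoeff_mul, leadingCoeff_X_sub_C,
      leadingCoeff_X_pow_sub_C (show 0 < l by omega),
      leadingCoeff_X_pow_sub_C (show 0 < n by omega),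
      mul_one, div_one] using this
  · have hd : ((X ^ l - C 1) * (X - C 1) : ℝ[X]).degree < (X ^ n - C 1 : ℝ[X]).degree := by
      rcases Nat.eq_zero_or_pos l with rfl | h0
      · rw [hdn, pow_zero, C_1, sub_self, zero_mul, degree_zero]
        exact WithBot.bot_lt_coe n
      · rw [hdl h0, hdn]
        exact_mod_cast (show l + 1 < n by omega)
    have := (div_tendsto_atTop_zero_of_degree_lt _ _ hd).comp
      (tendsto_natCast_atTop_atTop (R := ℝ))
    simpa only [Function.comp_def, hev] using this

section Limit

variable {V : Type*} [NormedAddCommGroup V] [NormedSpace ℝ V] [FiniteDimensional ℝ V]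
  {L : Submodule ℤ V} {P : Set V}

/-- The coefficients of the limit are `c_l`, doubled for `l = n - 1`: its constant term `1`
is `c_0`. -/
theorem coeff_limitPolynomial {n : ℕ} (hn : 2 ≤ n) (hP : IsLatticePolytope L P)
    (hL : IsLattice L) (l : ℕ) :
    (C (2 * ((ehrhartPolynomial L P).coeff (n - 1) : ℝ)) * X ^ (n - 1)
        + ∑ i ∈ Finset.Ico 1 (n - 1), C ((ehrhartPolynomial L P).coeff i : ℝ) * X ^ i
        + 1 : ℝ[X]).coeff l =
      if l < n then (1 + if l = n - 1 then 1 else 0) * (realEhrhart L P).coeff l else 0 := by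
  have hcoeff : ∀ i, ((ehrhartPolynomial L P).coeff i : ℝ) = (realEhrhart L P).coeff i :=
    fun i => by simp
  have h1 : (realEhrhart L P).coeff 0 = 1 := by
    rw [← hcoeff, hP.coeff_zero_ehrhartPolynomial hL, Rat.cast_one]
  simp only [coeff_add, coeff_C_mul, coeff_X_pow, finsetSum_coeff, coeff_one, mul_ite, mul_one,
    mul_zero, Finset.sum_ite_eq, Finset.mem_Ico, hcoeff]
  rcases Nat.eq_zero_or_pos l with rfl | h0
  · simp [h1, show 0 < n by omega, show 0 ≠ n - 1 by omega]
  · rcases lt_trichotomy l (n - 1) with h | h | h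
    · simp [h, h.ne, h0.ne', show 1 ≤ l by omega, show l < n by omega]
    · have h2 : n - 1 < n := by omega
      have h3 : n - 1 ≠ 0 := by omega
      subst h
      norm_num [h2, h3]
    · simp [h.ne', h0.ne', show ¬ l < n - 1 by omega, show ¬ l < n by omega]

variable [MeasurableSpace V] [BorelSpace V]

theorem tendsto_coeff_averageRegularizedEhrhart [Nontrivial V] {n : ℕ} (hn : 2 ≤ n)
    (hV : Module.finrank ℝ V = n) (hP : IsLatticePolytope L P) (hL : IsLattice L) (l : ℕ) :
    Tendsto (fun p : ℕ => (averageRegularizedEhrhart (superlattices L p) P).coeff l)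
      (atTop ⊓ 𝓟 {p : ℕ | p.Prime})
      (𝓝 (if l < n then (1 + if l = n - 1 then 1 else 0) * (realEhrhart L P).coeff l else 0)) := by
  by_cases hl : l < n
  · rw [if_pos hl]
    have hlim := ((tendsto_pow_sub_one_mul_div hn hl).const_add 1).mul_const
      ((realEhrhart L P).coeff l)
    refine (hlim.mono_left inf_le_left).congr' ?_
    filter_upwards [mem_inf_of_right (mem_principal_self _)] with p hp
    rw [coeff_averageRegularizedEhrhart_of_lt hP hL hp (hV ▸ hl), hV]
  · rw [if_neg hl]
    refine tendsto_const_nhds.congr' ?_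
    filter_upwards [mem_inf_of_right (mem_principal_self _)] with p hp
    rw [coeff_averageRegularizedEhrhart_of_le hP hL hp (hV ▸ not_lt.mp hl)]

end Limit

end EhrhartAverage

theorem mainTheorem4 {V : Type*} [NormedAddCommGroup V] [NormedSpace ℝ V]
    [FiniteDimensional ℝ V] [MeasurableSpace V] [BorelSpace V]
    (n : ℕ) (hn : 2 ≤ n) (hV : Module.finrank ℝ V = n)
    (L : Submodule ℤ V) (hL : EhrhartAverage.IsLattice L)
    (P : Set V) (hP : EhrhartAverage.IsLatticePolytope L P) :
    -- the objects exist: `E(P)`, all the `E(P_M)`, and the averages, which have degree `< n`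
    EhrhartAverage.IsEhrhartPolynomial L P (EhrhartAverage.ehrhartPolynomial L P) ∧
    (∀ p : ℕ, p.Prime →
      (EhrhartAverage.superlattices L p).Finite ∧
      (EhrhartAverage.superlattices L p).Nonempty ∧
      (∀ M ∈ EhrhartAverage.superlattices L p,
        EhrhartAverage.IsEhrhartPolynomial M P (EhrhartAverage.ehrhartPolynomial M P)) ∧
      (EhrhartAverage.averageRegularizedEhrhart
        (EhrhartAverage.superlattices L p) P).degree < n) ∧
    -- the averages converge, coefficient by coefficient, as `p → ∞` through the primes
    ∀ l : ℕ, Tendsto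
      (fun p : ℕ => (EhrhartAverage.averageRegularizedEhrhart
        (EhrhartAverage.superlattices L p) P).coeff l)
      (atTop ⊓ 𝓟 {p : ℕ | p.Prime})
      (𝓝 ((C (2 * ((EhrhartAverage.ehrhartPolynomial L P).coeff (n - 1) : ℝ)) * X ^ (n - 1)
        + ∑ i ∈ Finset.Ico 1 (n - 1),
            C ((EhrhartAverage.ehrhartPolynomial L P).coeff i : ℝ) * X ^ i
        + 1 : ℝ[X]).coeff l)) := by
  have : Nontrivial V := Module.nontrivial_of_finrank_pos (R := ℝ) (by omega)
  refine ⟨hP.isEhrhartPolynomial hL, fun p hp => ⟨EhrhartAverage.finite_superlattices hL hp, ?_,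
    fun M hM => (hP.mono hM.2.1).isEhrhartPolynomial hM.1, ?_⟩, fun l => ?_⟩
  · by_contra h
    have hpos := EhrhartAverage.ncard_superlattices_pos hP hL hp
    rw [Set.not_nonempty_iff_eq_empty.mp h] at hpos
    simp at hpos
  · exact (degree_lt_iff_coeff_zero _ _).mpr fun l hl =>
      EhrhartAverage.coeff_averageRegularizedEhrhart_of_le hP hL hp (hV ▸ hl)
  rw [EhrhartAverage.coeff_limitPolynomial hn hP hL]
  exact EhrhartAverage.tendsto_coeff_averageRegularizedEhrhart hn hV hP hL l
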